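/- For an integer $m\ge 2$ let $\mathrm D=\mathrm D(\mathbb C^m)$ be the set of quantum states on $\mathbb C^m$, that is, of all positive semidefinite Hermitian complex $m\times m$ matrices of trace $1$. It is a convex body in the real affine space $H$ of Hermitian $m\times m$ matrices of trace $1$, which has dimension $m^2-1$. Take the maximally mixed state $\rho_*=\mathrm{Id}/m$ as the origin of $H$, so that for $t\ge 0$ the dilate of $\mathrm D$ is $t\bullet \mathrm D=\{t\rho+(1-t)\rho_* : \rho\in \mathrm D\}$. Let $$\dim_V(\mathrm D)=\log\inf\{N : \text{there is a convex polytope } P \text{ with } N \text{ vertices such that } \mathrm D\subset P\subset 4\bullet \mathrm D\}$$ be the verticial dimension of $\mathrm D$, and let $$\dim_F(\mathrm D)=\log\inf\{N : \text{there is a convex polytope } Q \text{ with } N \text{ facets such that } \mathrm D\subset Q\subset 4\bullet \mathrm D\}$$ be its facial dimension, where facets are faces of dimension $m^2-2$. Then $$\dim_F(\mathrm D(\mathbb C^m))=\dim_V(\mathrm D(\mathbb C^m))=\Theta(m);$$ that is, the two dimensions are equal for every $m\ge 2$, and there are absolute constants $c,C>0$ such that $c\,m\le \dim_V(\mathrm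 D(\mathbb C^m))\le C\,m$ for all $m\ge 2$. -/

import Mathlib

open scoped ComplexOrder

/-- A (convex) polytope: the convex hull of a finite set of points. -/
def IsPolytope {E : Type*} [AddCommGroup E] [Module ℝ E] (P : Set E) : Prop :=
  ∃ s : Set E, s.Finite ∧ P = convexHull ℝ s

/-- The vertices of a polytope are its extreme points. -/
def vertexSet {E : Type*} [AddCommGroup E] [Module ℝ E] (P : Set E) : Set E :=
  Set.extremePoints ℝ P

/-- `F` is a facet of `P`: a nonempty (exposed) face of `P` whose dimension is one less than the
dimension of `P`, the dimension of a set being that of its affine span. -/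
def IsFacet {E : Type*} [AddCommGroup E] [Module ℝ E] [TopologicalSpace E] (P F : Set E) : Prop :=
  F.Nonempty ∧ IsExposed ℝ P F ∧
    Module.finrank ℝ (vectorSpan ℝ F) + 1 = Module.finrank ℝ (vectorSpan ℝ P)

/-- The set of facets of `P`. -/
def facetSet {E : Type*} [AddCommGroup E] [Module ℝ E] [TopologicalSpace E] (P : Set E) :
    Set (Set E) :=
  {F | IsFacet P F}

/-- The verticial dimension `dim_V(K, A)` of a convex body `K`, where the point `o` plays the
role of the origin: `A K` is the image of `K` under `x ↦ o + A (x - o)`. The body `K` is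
full-dimensional in its affine span, which contains `o`; a set `P` with `K ⊆ P ⊆ A K` has the same
affine span, so that it does not matter in which larger space this span is placed. -/
noncomputable def verticialDim {E : Type*} [AddCommGroup E] [Module ℝ E]
    (o : E) (K : Set E) (A : ℝ) : ℝ :=
  Real.log (sInf {N : ℕ | ∃ P : Set E, IsPolytope P ∧ (vertexSet P).encard = N ∧
    K ⊆ P ∧ P ⊆ AffineMap.homothety o A '' K} : ℕ)

/-- The facial dimension `dim_F(K, A)` of a convex body `K`, where the point `o` plays the role of
the origin. The facets of a polytope `Q` with `K ⊆ Q ⊆ A K` are its faces of codimension one in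
the common affine span of `K` and `Q`. -/
noncomputable def facialDim {E : Type*} [AddCommGroup E] [Module ℝ E] [TopologicalSpace E]
    (o : E) (K : Set E) (A : ℝ) : ℝ :=
  Real.log (sInf {N : ℕ | ∃ Q : Set E, IsPolytope Q ∧ (facetSet Q).encard = N ∧
    K ⊆ Q ∧ Q ⊆ AffineMap.homothety o A '' K} : ℕ)

/-- The set `D(ℂ^m)` of quantum states: positive semidefinite (in particular Hermitian) complex
matrices of trace one. -/
def quantumStates (m : ℕ) : Set (Matrix (Fin m) (Fin m) ℂ) :=
  {ρ | ρ.PosSemidef ∧ ρ.trace = 1}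

/-- The maximally mixed state `ρ_* = Id / m`. -/
noncomputable def maximallyMixed (m : ℕ) : Matrix (Fin m) (Fin m) ℂ :=
  (m : ℂ)⁻¹ • (1 : Matrix (Fin m) (Fin m) ℂ)

/-!
Since the cone of positive semidefinite matrices is self-dual, the set of quantum states is its own
polar about `ρ_*` with respect to the form `(σ, ρ) ↦ -m Re tr (σ ρ)`. Polarity turns a polytope
between `D` and `4 D` into another one, and exchanges vertices and facets; hence the equality of
the two dimensions.

Upper bound: if the coordinates of a vector `y` of square norm `m` are rounded to integers at random
and without bias, then `y yᴴ` grows in mean by at most `2 Id`. The rounded vectors are Gaussian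
integer vectors of `ℓ¹` norm at most `6 m`, of which there are only exponentially many in `m`. The
projections onto them therefore generate a cone containing `ρ + 2 ρ_*` for every state `ρ`.

Lower bound: for a vector of signs `ε`, the functional `ρ ↦ ⟨ε, ρ ε⟩` attains the value `m` on `D`,
so it is at least `m / 4` at the contraction to `D` of some vertex of the polytope. For a fixed
state its average over `ε` is `1`, with a bounded exponential moment, so a single vertex can only
serve an exponentially small fraction of the signs.
-/

open Filter Topology

section Faces

variable {E : Type*} [AddCommGroup E] [Module ℝ E]

lemma vectorSpan_le_ker_of_forall_apply_eq {f : E →ₗ[ℝ] ℝ} {S : Set E}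
    (h : ∀ x ∈ S, ∀ y ∈ S, f x = f y) : vectorSpan ℝ S ≤ LinearMap.ker f := by
  rw [vectorSpan_def, Submodule.span_le]
  rintro _ ⟨x, hx, y, hy, rfl⟩
  simp [h x hx y hy]

/-- The points of `P` on the hyperplane `f (x - o) = 1`; a face of `P` when that hyperplane
supports `P`. -/
def supportFace (f : E →ₗ[ℝ] ℝ) (o : E) (P : Set E) : Set E :=
  {x ∈ P | f (x - o) = 1}

variable {f : E →ₗ[ℝ] ℝ} {o : E} {P : Set E}

lemma vectorSpan_supportFace_lt (ho : o ∈ P) (hne : (supportFace f o P).Nonempty) :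
    vectorSpan ℝ (supportFace f o P) < vectorSpan ℝ P := by
  obtain ⟨a, haP, ha⟩ := hne
  have hker : vectorSpan ℝ (supportFace f o P) ≤ LinearMap.ker f :=
    vectorSpan_le_ker_of_forall_apply_eq fun x hx y hy => by
      simpa only [map_sub, sub_left_inj] using hx.2.trans hy.2.symm
  refine lt_of_le_of_ne (vectorSpan_mono ℝ (Set.sep_subset _ _)) fun heq => ?_
  have hao : a - o ∈ vectorSpan ℝ (supportFace f o P) := heq ▸ vsub_mem_vectorSpan ℝ haP ho
  exact one_ne_zero (ha.symm.trans (hker hao))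

variable [TopologicalSpace E]

lemma isExposed_supportFace [IsTopologicalAddGroup E] [ContinuousSMul ℝ E] [T2Space E]
    [FiniteDimensional ℝ E] (hf : ∀ x ∈ P, f (x - o) ≤ 1) : IsExposed ℝ P (supportFace f o P) := by
  rintro ⟨a, haP, ha⟩
  refine ⟨LinearMap.toContinuousLinearMap f, Set.ext fun x => and_congr_right fun hx => ?_⟩
  simp only [LinearMap.coe_toContinuousLinearMap', map_sub] at ha hf ⊢
  exact ⟨fun hx1 y hy => by linarith [hf y hy], fun h => by linarith [hf x hx, h a haP]⟩

lemma mem_of_isExposed_of_sub_mem_vectorSpan {F : Set E} (hF : IsExposed ℝ P F) {a y : E}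
    (ha : a ∈ F) (hy : y ∈ P) (hya : y - a ∈ vectorSpan ℝ F) : y ∈ F := by
  obtain ⟨l, rfl⟩ := hF ⟨a, ha⟩
  have hker : vectorSpan ℝ {x ∈ P | ∀ y ∈ P, l y ≤ l x} ≤ LinearMap.ker (l : E →ₗ[ℝ] ℝ) :=
    vectorSpan_le_ker_of_forall_apply_eq fun x hx y hy => le_antisymm (hy.2 x hx.1) (hx.2 y hy.1)
  have hly : l y = l a := sub_eq_zero.1 ((map_sub l y a).symm.trans (hker hya))
  exact ⟨hy, fun x hx => hly ▸ ha.2 x hx⟩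

end Faces

section Convexity

variable {E : Type*} [AddCommGroup E] [Module ℝ E]

lemma exists_forall_lt_of_convexOn {ι : Type*} {s : Set ι} (hs : s.Finite) {F : Set E}
    (hF : Convex ℝ F) (hne : F.Nonempty) {f : ι → E → ℝ} {c : ℝ}
    (hf : ∀ i ∈ s, ConvexOn ℝ F (f i)) (hle : ∀ i ∈ s, ∀ x ∈ F, f i x ≤ c)
    (hlt : ∀ i ∈ s, ∃ x ∈ F, f i x < c) : ∃ x ∈ F, ∀ i ∈ s, f i x < c := by
  induction s, hs using Set.Finite.induction_on with
  | empty => exact hne.imp fun x hx => ⟨hx, by simp⟩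
  | @insert j s _ _ ih =>
    simp only [Set.forall_mem_insert] at hf hle hlt
    obtain ⟨x, hx, hxs⟩ := ih hf.2 hle.2 hlt.2
    obtain ⟨y, hy, hyj⟩ := hlt.1
    have midpoint_le : ∀ i, ConvexOn ℝ F (f i) →
        f i ((1 / 2 : ℝ) • x + (1 / 2 : ℝ) • y) ≤ 1 / 2 * f i x + 1 / 2 * f i y := fun i hi =>
      hi.2 hx hy (by norm_num) (by norm_num) (by norm_num)
    refine ⟨(1 / 2 : ℝ) • x + (1 / 2 : ℝ) • y,
      hF hx hy (by norm_num) (by norm_num) (by norm_num), ?_⟩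
    rw [Set.forall_mem_insert]
    exact ⟨by linarith [midpoint_le j hf.1, hle.1 x hx], fun i hi => by
      linarith [midpoint_le i (hf.2 i hi), hxs i hi, hle.2 i hi y hy]⟩

lemma mem_homothety_image_iff {o x : E} {K : Set E} {A : ℝ} (hA : A ≠ 0) :
    x ∈ AffineMap.homothety o A '' K ↔ o + A⁻¹ • (x - o) ∈ K := by
  constructor
  · rintro ⟨y, hy, rfl⟩
    simpa [AffineMap.homothety_apply, smul_smul, inv_mul_cancel₀ hA] using hy
  · exact fun h => ⟨_, h, by simp [AffineMap.homothety_apply, smul_smul, mul_inv_cancel₀ hA]⟩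

lemma IsPolytope.finite_vertexSet {P : Set E} (hP : IsPolytope P) : (vertexSet P).Finite := by
  obtain ⟨s, hs, rfl⟩ := hP
  exact hs.subset extremePoints_convexHull_subset

variable [TopologicalSpace E] [IsTopologicalAddGroup E] [ContinuousSMul ℝ E] [T2Space E]
  [LocallyConvexSpace ℝ E]

lemma convexHull_extremePoints_of_isCompact {K : Set E} (hK : IsCompact K) (hconv : Convex ℝ K)
    (hfin : (K.extremePoints ℝ).Finite) : convexHull ℝ (K.extremePoints ℝ) = K := by
  rw [← (hfin.isCompact_convexHull ℝ).isClosed.closure_eq]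
  exact closure_convexHull_extremePoints hK hconv

lemma IsPolytope.convexHull_vertexSet {P : Set E} (hP : IsPolytope P) :
    convexHull ℝ (vertexSet P) = P := by
  have hfin := hP.finite_vertexSet
  obtain ⟨s, hs, rfl⟩ := hP
  exact convexHull_extremePoints_of_isCompact (hs.isCompact_convexHull ℝ)
    (convex_convexHull ℝ s) hfin

lemma IsPolytope.exists_mem_vertexSet_le {P : Set E} (hP : IsPolytope P) (l : E →ₗ[ℝ] ℝ) {x : E}
    (hx : x ∈ P) : ∃ v ∈ vertexSet P, l x ≤ l v :=
  (l.convexOn convex_univ).exists_ge_of_mem_convexHull (Set.subset_univ _)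
    (hP.convexHull_vertexSet.symm ▸ hx)

lemma IsPolytope.nontrivial_vertexSet {P : Set E} (hP : IsPolytope P) (h : P.Nontrivial) :
    (vertexSet P).Nontrivial := by
  by_contra hV
  rw [← hP.convexHull_vertexSet] at h
  rcases (Set.not_nontrivial_iff.1 hV).eq_empty_or_singleton with h₀ | ⟨v, h₀⟩ <;>
    simp [h₀] at h

end Convexity

/-- The polar of `S` inside the affine subspace `o + W`, with respect to the bilinear form `B` and
the origin `o`. -/
def affinePolar {E : Type*} [AddCommGroup E] [Module ℝ E] (B : LinearMap.BilinForm ℝ E)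
    (W : Submodule ℝ E) (o : E) (S : Set E) : Set E :=
  {x | x - o ∈ W ∧ ∀ v ∈ S, B (v - o) (x - o) ≤ 1}

section AffinePolar

variable {E : Type*} [AddCommGroup E] [Module ℝ E] {B : LinearMap.BilinForm ℝ E}
  {W : Submodule ℝ E} {o : E}

lemma self_mem_affinePolar (S : Set E) : o ∈ affinePolar B W o S :=
  ⟨by simp, fun v _ => by simp⟩

lemma affinePolar_eq_preimage (S : Set E) : affinePolar B W o S =
    (AffineEquiv.vaddConst ℝ o).symm ⁻¹' (W ∩ ⋂ v ∈ S, {y | B (v - o) y ≤ 1}) := by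
  ext x
  simp only [affinePolar, Set.mem_ofPred_eq, Set.mem_preimage, AffineEquiv.vaddConst_symm_apply,
    vsub_eq_sub, Set.mem_inter_iff, SetLike.mem_coe, Set.mem_iInter]

lemma convex_affinePolar (S : Set E) : Convex ℝ (affinePolar B W o S) := by
  rw [affinePolar_eq_preimage]
  exact (W.convex.inter (convex_iInter₂ fun v _ =>
    convex_halfSpace_le (B (v - o)).isLinear 1)).affine_preimage
      (AffineEquiv.vaddConst ℝ o).symm.toAffineMap

lemma affinePolar_convexHull (S : Set E) :
    affinePolar B W o (convexHull ℝ S) = affinePolar B W o S := by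
  ext x
  refine and_congr_right fun _ => ⟨fun h v hv => h v (subset_convexHull ℝ S hv), fun h => ?_⟩
  exact convexHull_min h <| (convex_halfSpace_le (B.flip (x - o)).isLinear 1).affine_preimage
    (AffineEquiv.vaddConst ℝ o).symm.toAffineMap

lemma exists_pos_add_smul_mem_affinePolar {V : Set E} (hV : V.Finite) {x z : E}
    (hx : x ∈ affinePolar B W o V) (hz : z ∈ W)
    (hactive : ∀ v ∈ V, B (v - o) (x - o) = 1 → B (v - o) z = 0) :
    ∃ t : ℝ, 0 < t ∧ x + t • z ∈ affinePolar B W o V ∧ x - t • z ∈ affinePolar B W o V := by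
  have hev : ∀ᶠ t : ℝ in 𝓝 0, x + t • z ∈ affinePolar B W o V := by
    simp only [affinePolar, Set.mem_ofPred_eq, add_sub_right_comm x, map_add, map_smul, smul_eq_mul,
      W.add_mem hx.1 (W.smul_mem _ hz), true_and]
    refine (eventually_all_finite hV).2 fun v hv => ?_
    rcases (hx.2 v hv).lt_or_eq with hlt | heq
    · have hcont : Tendsto (fun t : ℝ => B (v - o) (x - o) + t * B (v - o) z) (𝓝 0)
          (𝓝 (B (v - o) (x - o))) := Continuous.tendsto' (by fun_prop) _ _ (by simp)
      exact (hcont.eventually_lt_const hlt).mono fun t ht => ht.le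
    · exact Eventually.of_forall fun t => by rw [heq, hactive v hv heq, mul_zero, add_zero]
  have hev_neg : ∀ᶠ t : ℝ in 𝓝 0, x + (-t) • z ∈ affinePolar B W o V :=
    (continuous_neg.tendsto' (0 : ℝ) 0 neg_zero).eventually hev
  obtain ⟨t, ⟨hadd, hsub⟩, ht⟩ := ((hev.and hev_neg).filter_mono nhdsWithin_le_nhds
    |>.and (self_mem_nhdsWithin : Set.Ioi (0 : ℝ) ∈ 𝓝[>] 0)).exists
  exact ⟨t, ht, hadd, by rwa [neg_smul, ← sub_eq_add_neg] at hsub⟩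

lemma eq_zero_of_mem_extremePoints_affinePolar {V : Set E} (hV : V.Finite) {x z : E}
    (hx : x ∈ (affinePolar B W o V).extremePoints ℝ) (hz : z ∈ W)
    (hactive : ∀ v ∈ V, B (v - o) (x - o) = 1 → B (v - o) z = 0) : z = 0 := by
  obtain ⟨t, ht, hadd, hsub⟩ := exists_pos_add_smul_mem_affinePolar hV hx.1 hz hactive
  have hmid : x ∈ openSegment ℝ (x + t • z) (x - t • z) :=
    ⟨1 / 2, 1 / 2, by norm_num, by norm_num, by norm_num, by module⟩
  have hxz : x + t • z = x := hx.2 hadd hsub hmid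
  exact (smul_eq_zero.1 (add_eq_left.1 hxz)).resolve_left ht.ne'

lemma eq_of_mem_extremePoints_affinePolar {V : Set E} (hV : V.Finite) {x y : E}
    (hx : x ∈ (affinePolar B W o V).extremePoints ℝ) (hy : y - o ∈ W)
    (hactive : ∀ v ∈ V, B (v - o) (x - o) = 1 → B (v - o) (y - o) = 1) : x = y := by
  have hsub : x - y = (x - o) - (y - o) := by abel
  refine sub_eq_zero.1 (eq_zero_of_mem_extremePoints_affinePolar hV hx ?_ fun v hv hv1 => ?_)
  · exact hsub ▸ W.sub_mem hx.1.1 hy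
  · rw [hsub, map_sub, hv1, hactive v hv hv1, sub_self]

lemma finite_extremePoints_affinePolar {V : Set E} (hV : V.Finite) :
    ((affinePolar B W o V).extremePoints ℝ).Finite := by
  refine Set.Finite.of_finite_image (f := fun x => {v ∈ V | B (v - o) (x - o) = 1})
    (hV.finite_subsets.subset ?_) fun x hx y hy hxy => ?_
  · rintro _ ⟨x, -, rfl⟩
    exact Set.sep_subset _ _
  · exact eq_of_mem_extremePoints_affinePolar hV hx hy.1.1 fun v hv hv1 =>
      ((Set.ext_iff.1 hxy v).1 ⟨hv, hv1⟩).2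

lemma finrank_le_of_forall_apply_eq_zero {U : Submodule ℝ E} [FiniteDimensional ℝ U]
    (h : ∀ z ∈ W, (∀ u ∈ U, B u z = 0) → z = 0) : Module.finrank ℝ W ≤ Module.finrank ℝ U := by
  rw [← Subspace.dual_finrank_eq (K := ℝ) (V := U)]
  refine LinearMap.finrank_le_finrank_of_injective (f := (B.domRestrict₁₂ U W).flip)
    ((injective_iff_map_eq_zero _).2 fun z hz => Subtype.ext (h z z.2 fun u hu => ?_))
  exact LinearMap.congr_fun hz ⟨u, hu⟩

section Facets

variable [TopologicalSpace E]

lemma eq_of_isExposed_affinePolar_of_forall_lt {V F : Set E} (hV : V.Finite)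
    (hF : IsExposed ℝ (affinePolar B W o V) F) {x : E} (hx : x ∈ F)
    (hlt : ∀ v ∈ V, B (v - o) (x - o) < 1) : F = affinePolar B W o V := by
  obtain ⟨l, rfl⟩ := hF ⟨x, hx⟩
  have hl : ∀ z ∈ W, l z = 0 := fun z hz => by
    obtain ⟨t, ht, hadd, hsub⟩ := exists_pos_add_smul_mem_affinePolar hV hx.1 hz
      fun v hv hv1 => absurd hv1 (hlt v hv).ne
    have hle := hx.2 _ hadd
    have hge := hx.2 _ hsub
    simp only [map_add, map_sub, map_smul, smul_eq_mul] at hle hge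
    exact (mul_eq_zero.1 (by linarith : t * l z = 0)).resolve_left ht.ne'
  refine Set.sep_eq_self_iff_mem_true.2 fun y hy w hw => le_of_eq ?_
  have hwy := hl _ (W.sub_mem hw.1 hy.1)
  rwa [sub_sub_sub_cancel_right, map_sub, sub_eq_zero] at hwy

lemma exists_subset_supportFace_of_isFacet {V F : Set E} (hV : V.Finite)
    (hF : IsFacet (affinePolar B W o V) F) :
    ∃ v ∈ V, F ⊆ supportFace (B (v - o)) o (affinePolar B W o V) := by
  obtain ⟨hne, hexp, hrank⟩ := hF
  by_contra! hcon
  have hF := hexp.convex (convex_affinePolar V)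
  have hle : ∀ v ∈ V, ∀ x ∈ F, B (v - o) (x - o) ≤ 1 := fun v hv x hx => (hexp.subset hx).2 v hv
  obtain ⟨x, hx, hlt⟩ := exists_forall_lt_of_convexOn (f := fun v x => B (v - o) (x - o)) hV hF hne
    (fun v _ => ((((B (v - o)).convexOn convex_univ).comp_affineMap
      (AffineEquiv.vaddConst ℝ o).symm.toAffineMap).subset (Set.subset_univ _) hF)) hle
    fun v hv => by
      obtain ⟨x, hx, hx1⟩ := Set.not_subset.1 (hcon v hv)
      exact ⟨x, hx, (hle v hv x hx).lt_of_ne fun h => hx1 ⟨hexp.subset hx, h⟩⟩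
  rw [eq_of_isExposed_affinePolar_of_forall_lt hV hexp hx hlt] at hrank
  omega

variable [FiniteDimensional ℝ E]

lemma exists_eq_supportFace_of_isFacet {V F : Set E} (hV : V.Finite)
    (hF : IsFacet (affinePolar B W o V) F) :
    ∃ v ∈ V, supportFace (B (v - o)) o (affinePolar B W o V) = F := by
  obtain ⟨v, hv, hFv⟩ := exists_subset_supportFace_of_isFacet hV hF
  obtain ⟨⟨a, ha⟩, hexp, hrank⟩ := hF
  refine ⟨v, hv, Set.Subset.antisymm (fun y hy => ?_) hFv⟩
  have hlt := Submodule.finrank_lt_finrank_of_lt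
    (vectorSpan_supportFace_lt (self_mem_affinePolar V) ⟨a, hFv ha⟩)
  have hspan : vectorSpan ℝ F = vectorSpan ℝ (supportFace (B (v - o)) o (affinePolar B W o V)) :=
    Submodule.eq_of_le_of_finrank_le (vectorSpan_mono ℝ hFv) (by omega)
  exact mem_of_isExposed_of_sub_mem_vectorSpan hexp ha hy.1
    (hspan ▸ vsub_mem_vectorSpan ℝ hy (hFv ha))

lemma encard_facetSet_affinePolar_le {V : Set E} (hV : V.Finite) :
    (facetSet (affinePolar B W o V)).encard ≤ V.encard :=
  (Set.encard_le_encard fun _ hF => exists_eq_supportFace_of_isFacet hV hF).trans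
    (Set.encard_image_le _ _)

variable [IsTopologicalAddGroup E] [ContinuousSMul ℝ E] [T2Space E]

lemma isClosed_affinePolar (S : Set E) : IsClosed (affinePolar B W o S) := by
  rw [affinePolar_eq_preimage]
  refine (W.closed_of_finiteDimensional.inter (isClosed_biInter fun v _ => ?_)).preimage
    (continuous_id.sub continuous_const)
  exact isClosed_le (B (v - o)).continuous_of_finiteDimensional continuous_const

lemma isPolytope_affinePolar [LocallyConvexSpace ℝ E] {V C : Set E} (hV : V.Finite)
    (hC : IsCompact C) (hVC : affinePolar B W o V ⊆ C) : IsPolytope (affinePolar B W o V) :=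
  ⟨_, finite_extremePoints_affinePolar hV,
    (convexHull_extremePoints_of_isCompact (hC.of_isClosed_subset (isClosed_affinePolar V) hVC)
      (convex_affinePolar V) (finite_extremePoints_affinePolar hV)).symm⟩

lemma isFacet_supportFace_of_mem_vertexSet_affinePolar {s : Set E} (hs : s.Finite)
    (ho : o ∈ convexHull ℝ s) (hsW : vectorSpan ℝ (convexHull ℝ s) ≤ W) (hW : W ≠ ⊥) {w : E}
    (hw : w ∈ vertexSet (affinePolar B W o s)) :
    IsFacet (convexHull ℝ s) (supportFace (B.flip (w - o)) o (convexHull ℝ s)) := by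
  set F := supportFace (B.flip (w - o)) o (convexHull ℝ s) with hF
  have mem_F : ∀ v ∈ s, B (v - o) (w - o) = 1 → v ∈ F := fun v hv hv1 =>
    ⟨subset_convexHull ℝ s hv, hv1⟩
  obtain ⟨v₀, hv₀⟩ : F.Nonempty := by
    obtain ⟨z, hz, hz0⟩ := W.ne_bot_iff.1 hW
    by_contra! hempty
    refine hz0 (eq_zero_of_mem_extremePoints_affinePolar hs hw hz fun v hv hv1 => ?_)
    exact absurd (mem_F v hv hv1) (hempty ▸ Set.notMem_empty v)
  have hle : ∀ x ∈ convexHull ℝ s, B (x - o) (w - o) ≤ 1 :=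
    ((affinePolar_convexHull (B := B) (W := W) (o := o) s).symm ▸ hw.1).2
  refine ⟨⟨v₀, hv₀⟩, isExposed_supportFace hle, ?_⟩
  have hlt := Submodule.finrank_lt_finrank_of_lt (vectorSpan_supportFace_lt ho ⟨v₀, hv₀⟩)
  have hWU : Module.finrank ℝ W ≤
      Module.finrank ℝ (Submodule.span ℝ {v₀ - o} ⊔ vectorSpan ℝ F : Submodule ℝ E) := by
    refine finrank_le_of_forall_apply_eq_zero (B := B) fun z hz hzU =>
      eq_zero_of_mem_extremePoints_affinePolar hs hw hz fun v hv hv1 => hzU _ ?_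
    rw [← sub_add_sub_cancel' v₀ o v]
    exact Submodule.add_mem_sup (Submodule.mem_span_singleton_self _)
      (vsub_mem_vectorSpan ℝ (mem_F v hv hv1) hv₀)
  have hUF := Submodule.finrank_add_le_finrank_add_finrank (Submodule.span ℝ {v₀ - o})
    (vectorSpan ℝ F)
  have hline := finrank_span_le_card (R := ℝ) ({v₀ - o} : Set E)
  have hsub := Submodule.finrank_mono hsW
  rw [Set.toFinset_singleton, Finset.card_singleton] at hline
  rw [← hF] at hlt
  omega

lemma encard_vertexSet_affinePolar_le {s : Set E} (hs : s.Finite) (ho : o ∈ convexHull ℝ s)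
    (hsW : vectorSpan ℝ (convexHull ℝ s) ≤ W) (hW : W ≠ ⊥) :
    (vertexSet (affinePolar B W o s)).encard ≤ (facetSet (convexHull ℝ s)).encard := by
  have hinj : Set.InjOn (fun w => supportFace (B.flip (w - o)) o (convexHull ℝ s))
      (vertexSet (affinePolar B W o s)) := fun w hw w' hw' heq =>
    eq_of_mem_extremePoints_affinePolar hs hw hw'.1.1 fun v hv hv1 =>
      ((Set.ext_iff.1 heq v).1 ⟨subset_convexHull ℝ s hv, hv1⟩).2
  rw [← hinj.encard_image]
  refine Set.encard_le_encard ?_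
  rintro _ ⟨w, hw, rfl⟩
  exact isFacet_supportFace_of_mem_vertexSet_affinePolar hs ho hsW hW hw

end Facets

end AffinePolar

/-- A polytope `P` with `K ⊆ P ⊆ A K`, where the dilate `A K` is taken about `o`. -/
structure IsSandwichedPolytope {E : Type*} [AddCommGroup E] [Module ℝ E] (o : E) (K : Set E)
    (A : ℝ) (P : Set E) : Prop where
  isPolytope : IsPolytope P
  subset : K ⊆ P
  subset_homothety : P ⊆ AffineMap.homothety o A '' K

section SandwichedPolytope

variable {E : Type*} [AddCommGroup E] [Module ℝ E] {o : E} {K P : Set E} {A : ℝ}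

lemma log_natCast_le_log_natCast {m n : ℕ} (h : m ≤ n) : Real.log m ≤ Real.log n := by
  rcases m.eq_zero_or_pos with rfl | hm
  · simpa using Real.log_natCast_nonneg n
  · exact Real.log_le_log (mod_cast hm) (mod_cast h)

lemma IsSandwichedPolytope.verticialDim_le {N : ℕ} (hP : IsSandwichedPolytope o K A P)
    (hN : (vertexSet P).encard ≤ N) : verticialDim o K A ≤ Real.log N := by
  obtain ⟨k, hk, hkN⟩ := ENat.le_natCast_iff.1 hN
  refine log_natCast_le_log_natCast (le_trans (Nat.sInf_le ?_) hkN)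
  exact ⟨P, hP.isPolytope, hk, hP.subset, hP.subset_homothety⟩

lemma le_verticialDim {c : ℝ} (hP : IsSandwichedPolytope o K A P)
    (h : ∀ Q, IsSandwichedPolytope o K A Q → ∀ N : ℕ, (vertexSet Q).encard = N → c ≤ Real.log N) :
    c ≤ verticialDim o K A := by
  obtain ⟨Q, hQ, hN, hKQ, hQK⟩ := Nat.sInf_mem (s := {N : ℕ | ∃ P : Set E, IsPolytope P ∧
    (vertexSet P).encard = N ∧ K ⊆ P ∧ P ⊆ AffineMap.homothety o A '' K})
    ⟨_, P, hP.isPolytope, hP.isPolytope.finite_vertexSet.encard_eq_coe_toFinset_card, hP.subset,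
      hP.subset_homothety⟩
  exact h Q ⟨hQ, hKQ, hQK⟩ _ hN

variable {B : LinearMap.BilinForm ℝ E} {W : Submodule ℝ E}

lemma affinePolar_anti {S T : Set E} (h : S ⊆ T) : affinePolar B W o T ⊆ affinePolar B W o S :=
  fun _ hx => ⟨hx.1, fun v hv => hx.2 v (h hv)⟩

lemma affinePolar_smul_homothety_image (hA : A ≠ 0) (S : Set E) :
    affinePolar (A⁻¹ • B) W o (AffineMap.homothety o A '' S) = affinePolar B W o S := by
  ext x
  simp only [affinePolar, Set.mem_ofPred_eq, Set.forall_mem_image, AffineMap.homothety_apply,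
    vsub_eq_sub, vadd_eq_add, add_sub_cancel_right, LinearMap.smul_apply, map_smul,
    smul_smul, inv_mul_cancel₀ hA, one_smul]

lemma affinePolar_smul (hA : A ≠ 0) (S : Set E) :
    affinePolar (A⁻¹ • B) W o S = AffineMap.homothety o A '' affinePolar B W o S := by
  ext x
  simp only [mem_homothety_image_iff hA, affinePolar, Set.mem_ofPred_eq, add_sub_cancel_left,
    W.smul_mem_iff (inv_ne_zero hA), map_smul, LinearMap.smul_apply]

lemma IsSandwichedPolytope.vectorSpan_le (hA : A ≠ 0) (hK : affinePolar B W o K = K)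
    (hP : IsSandwichedPolytope o K A P) : vectorSpan ℝ P ≤ W := by
  refine (vectorSpan_mono ℝ hP.subset_homothety).trans ?_
  rw [← hK, ← affinePolar_smul hA, vectorSpan_def, Submodule.span_le]
  rintro _ ⟨x, hx, y, hy, rfl⟩
  simpa only [vsub_eq_sub, SetLike.mem_coe, sub_sub_sub_cancel_right] using W.sub_mem hx.1 hy.1

variable [TopologicalSpace E] [IsTopologicalAddGroup E] [ContinuousSMul ℝ E] [T2Space E]
  [FiniteDimensional ℝ E] [LocallyConvexSpace ℝ E]

lemma isSandwichedPolytope_affinePolar {s : Set E} (hs : s.Finite) (hA : A ≠ 0)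
    (hKc : IsCompact K) (hK : affinePolar B W o K = K)
    (hP : IsSandwichedPolytope o K A (convexHull ℝ s)) :
    IsSandwichedPolytope o K A (affinePolar (A⁻¹ • B) W o s) := by
  have hsub : affinePolar (A⁻¹ • B) W o s ⊆ AffineMap.homothety o A '' K := by
    calc affinePolar (A⁻¹ • B) W o s
        = affinePolar (A⁻¹ • B) W o (convexHull ℝ s) := (affinePolar_convexHull s).symm
      _ ⊆ affinePolar (A⁻¹ • B) W o K := affinePolar_anti hP.subset
      _ = AffineMap.homothety o A '' K := by rw [affinePolar_smul hA, hK]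
  refine ⟨isPolytope_affinePolar hs (hKc.image ?_) hsub, ?_, hsub⟩
  · exact AffineMap.homothety_continuous o A
  · calc K = affinePolar (A⁻¹ • B) W o (AffineMap.homothety o A '' K) := by
          rw [affinePolar_smul_homothety_image hA, hK]
      _ ⊆ affinePolar (A⁻¹ • B) W o (convexHull ℝ s) := affinePolar_anti hP.subset_homothety
      _ = affinePolar (A⁻¹ • B) W o s := affinePolar_convexHull s

theorem facialDim_eq_verticialDim_of_affinePolar_eq_self (hA : A ≠ 0) (hKc : IsCompact K)
    (hKn : K.Nontrivial) (hK : affinePolar B W o K = K) :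
    facialDim o K A = verticialDim o K A := by
  have hW : W ≠ ⊥ := by
    rintro rfl
    refine hKn.not_subsingleton fun x hx y hy => ?_
    rw [← hK] at hx hy
    exact (sub_eq_zero.1 hx.1).trans (sub_eq_zero.1 hy.1).symm
  refine congrArg (fun N : ℕ => Real.log N) (csInf_eq_csInf_of_forall_exists_le ?_ ?_)
  · rintro N ⟨P, ⟨s, hs, rfl⟩, hN, hKP, hPK⟩
    have hP : IsSandwichedPolytope o K A (convexHull ℝ s) := ⟨⟨s, hs, rfl⟩, hKP, hPK⟩
    have ho : o ∈ convexHull ℝ s := hKP (hK ▸ self_mem_affinePolar K)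
    obtain ⟨k, hk, hkN⟩ := ENat.le_natCast_iff.1 <|
      hN ▸ encard_vertexSet_affinePolar_le (B := A⁻¹ • B) hs ho (hP.vectorSpan_le hA hK) hW
    have hQ := isSandwichedPolytope_affinePolar hs hA hKc hK hP
    exact ⟨k, ⟨_, hQ.isPolytope, hk, hQ.subset, hQ.subset_homothety⟩, hkN⟩
  · rintro N ⟨P, hP, hN, hKP, hPK⟩
    obtain ⟨k, hk, hkN⟩ := ENat.le_natCast_iff.1 <|
      hN ▸ encard_facetSet_affinePolar_le (B := A⁻¹ • B) (W := W) (o := o) hP.finite_vertexSet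
    have hQ := isSandwichedPolytope_affinePolar hP.finite_vertexSet hA hKc hK
      (hP.convexHull_vertexSet.symm ▸ (⟨hP, hKP, hPK⟩ : IsSandwichedPolytope o K A P))
    exact ⟨k, ⟨_, hQ.isPolytope, hk, hQ.subset, hQ.subset_homothety⟩, hkN⟩

end SandwichedPolytope

open Matrix

section Dyad

variable {n : Type*}

/-- The rank-one matrix `x xᴴ` as a quadratic function of the vector `x`. -/
noncomputable def dyad (n : Type*) : QuadraticMap ℝ (n → ℂ) (Matrix n n ℂ) :=
  LinearMap.BilinMap.toQuadraticMap <| LinearMap.mk₂ ℝ (fun x y => vecMulVec x (star y))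
    (fun x x' y => add_vecMulVec x x' _) (fun c x y => smul_vecMulVec c x _)
    (fun x y y' => by rw [star_add, vecMulVec_add])
    (fun c x y => by rw [star_smul, star_trivial, vecMulVec_smul])

lemma dyad_apply (x : n → ℂ) : dyad n x = vecMulVec x (star x) := rfl

lemma posSemidef_dyad [Finite n] (x : n → ℂ) : (dyad n x).PosSemidef :=
  posSemidef_vecMulVec_self_star x

variable [Fintype n]

lemma trace_dyad (x : n → ℂ) : (dyad n x).trace = ((∑ k, ‖x k‖ ^ 2 : ℝ) : ℂ) := by
  rw [dyad_apply, trace_vecMulVec, dotProduct, Complex.ofReal_sum]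
  exact Finset.sum_congr rfl fun k _ => by rw [Complex.ofReal_pow]; exact RCLike.mul_conj (x k)

lemma trace_dyad_mul (x : n → ℂ) (A : Matrix n n ℂ) :
    (dyad n x * A).trace = star x ⬝ᵥ (A *ᵥ x) := by
  rw [dyad_apply, vecMulVec_mul, trace_vecMulVec, dotProduct_comm, dotProduct_mulVec]

lemma conjTranspose_mul_self_eq_sum_dyad (B : Matrix n n ℂ) :
    Bᴴ * B = ∑ r, dyad n (star (B r)) := by
  ext i j
  simp [mul_apply, Matrix.sum_apply, dyad_apply, vecMulVec_apply]

lemma sum_norm_sq_pos {x : n → ℂ} (hx : x ≠ 0) : 0 < ∑ k, ‖x k‖ ^ 2 := by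
  obtain ⟨k, hk⟩ := Function.ne_iff.1 hx
  exact Finset.sum_pos' (fun _ _ => by positivity)
    ⟨k, Finset.mem_univ k, pow_pos (norm_pos_iff.2 hk) 2⟩

/-- The projection onto the line spanned by `x`; the junk value at `x = 0` is `0`. -/
noncomputable def pureState (x : n → ℂ) : Matrix n n ℂ :=
  (∑ k, ‖x k‖ ^ 2)⁻¹ • dyad n x

lemma sum_norm_sq_smul_pureState {x : n → ℂ} (hx : x ≠ 0) :
    (∑ k, ‖x k‖ ^ 2) • pureState x = dyad n x :=
  smul_inv_smul₀ (sum_norm_sq_pos hx).ne' _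

open scoped MatrixOrder Matrix.Norms.L2Operator in
lemma exists_eq_conjTranspose_mul_self_of_posSemidef {ρ : Matrix n n ℂ} (h : ρ.PosSemidef) :
    ∃ B : Matrix n n ℂ, ρ = Bᴴ * B := by
  classical
  exact CStarAlgebra.nonneg_iff_eq_star_mul_self.mp h.nonneg

lemma re_trace_mul_nonneg_of_posSemidef {X Y : Matrix n n ℂ} (hX : X.PosSemidef)
    (hY : Y.PosSemidef) : 0 ≤ (X * Y).trace.re := by
  obtain ⟨C, rfl⟩ := exists_eq_conjTranspose_mul_self_of_posSemidef hX
  rw [Matrix.mul_assoc, trace_mul_comm]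
  exact (Complex.le_def.1 (hY.mul_mul_conjTranspose_same C).trace_nonneg).1

end Dyad

section QuantumStates

variable {m : ℕ}

lemma pureState_mem_quantumStates {x : Fin m → ℂ} (hx : x ≠ 0) :
    pureState x ∈ quantumStates m := by
  refine ⟨(posSemidef_dyad x).smul (inv_nonneg.2 (sum_norm_sq_pos hx).le), ?_⟩
  rw [pureState, trace_smul, trace_dyad, Complex.real_smul, ← Complex.ofReal_mul,
    inv_mul_cancel₀ (sum_norm_sq_pos hx).ne', Complex.ofReal_one]

lemma maximallyMixed_eq_real_smul (m : ℕ) :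
    maximallyMixed m = (m : ℝ)⁻¹ • (1 : Matrix (Fin m) (Fin m) ℂ) := by
  ext i j
  simp [maximallyMixed]

lemma maximallyMixed_mem_quantumStates (hm : m ≠ 0) : maximallyMixed m ∈ quantumStates m := by
  refine ⟨?_, by simp [maximallyMixed, hm]⟩
  rw [maximallyMixed_eq_real_smul]
  exact PosSemidef.one.smul (by positivity)

lemma quantumStates_nontrivial (hm : 2 ≤ m) : (quantumStates m).Nontrivial := by
  let e (i : Fin m) : Fin m → ℂ := Pi.single i 1
  have he (i : Fin m) : e i ≠ 0 := Pi.single_ne_zero_iff.2 one_ne_zero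
  refine ⟨_, pureState_mem_quantumStates (he ⟨0, by omega⟩), _,
    pureState_mem_quantumStates (he ⟨1, by omega⟩), fun h => ?_⟩
  have h00 := congrFun₂ h ⟨0, by omega⟩ ⟨0, by omega⟩
  simp [pureState, dyad_apply, vecMulVec_apply, e, Pi.single_apply, apply_ite] at h00

lemma convex_quantumStates (m : ℕ) : Convex ℝ (quantumStates m) := by
  rintro a ⟨ha, ha'⟩ b ⟨hb, hb'⟩ s t hs ht hst
  refine ⟨(ha.smul hs).add (hb.smul ht), ?_⟩
  rw [trace_add, trace_smul, trace_smul, ha', hb', ← add_smul, hst, one_smul]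

open scoped Matrix.Norms.Frobenius in
lemma trace_conjTranspose_mul_self_eq_norm_sq (B : Matrix (Fin m) (Fin m) ℂ) :
    (Bᴴ * B).trace = ((‖B‖ ^ 2 : ℝ) : ℂ) := by
  rw [conjTranspose_mul_self_eq_sum_dyad, trace_sum, frobenius_norm_def, ← Real.sqrt_eq_rpow,
    Real.sq_sqrt (by positivity), Complex.ofReal_sum]
  exact Finset.sum_congr rfl fun r _ => by simp [trace_dyad]

open scoped Matrix.Norms.Frobenius in
lemma isCompact_quantumStates (m : ℕ) : IsCompact (quantumStates m) := by
  have himage : quantumStates m = (fun B => Bᴴ * B) '' Metric.sphere 0 1 := by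
    ext ρ
    constructor
    · rintro ⟨hρ, htr⟩
      obtain ⟨B, rfl⟩ := exists_eq_conjTranspose_mul_self_of_posSemidef hρ
      rw [trace_conjTranspose_mul_self_eq_norm_sq] at htr
      refine ⟨B, mem_sphere_zero_iff_norm.2 ?_, rfl⟩
      exact (pow_eq_one_iff_of_nonneg (norm_nonneg B) two_ne_zero).1 (mod_cast htr)
    · rintro ⟨B, hB, rfl⟩
      refine ⟨posSemidef_conjTranspose_mul_self B, ?_⟩
      rw [trace_conjTranspose_mul_self_eq_norm_sq, mem_sphere_zero_iff_norm.1 hB]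
      norm_num
  rw [himage]
  have := FiniteDimensional.proper ℝ (Matrix (Fin m) (Fin m) ℂ)
  exact (isCompact_sphere _ _).image (by fun_prop)

/-- The real bilinear form `(X, Y) ↦ Re tr (X Y)`. -/
noncomputable def reTraceForm (m : ℕ) : LinearMap.BilinForm ℝ (Matrix (Fin m) (Fin m) ℂ) :=
  (LinearMap.mul ℝ _).compr₂ (Complex.reLm ∘ₗ traceLinearMap (Fin m) ℝ ℂ)

lemma reTraceForm_apply (X Y : Matrix (Fin m) (Fin m) ℂ) :
    reTraceForm m X Y = (X * Y).trace.re := rfl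

/-- The real space of traceless Hermitian matrices, the direction of the affine space spanned by
the quantum states. -/
noncomputable def tracelessHermitian (m : ℕ) : Submodule ℝ (Matrix (Fin m) (Fin m) ℂ) :=
  selfAdjoint.submodule ℝ _ ⊓ LinearMap.ker (traceLinearMap (Fin m) ℝ ℂ)

lemma sub_maximallyMixed_mem_tracelessHermitian_iff (hm : m ≠ 0) {x : Matrix (Fin m) (Fin m) ℂ} :
    x - maximallyMixed m ∈ tracelessHermitian m ↔ x.IsHermitian ∧ x.trace = 1 := by
  obtain ⟨hpos, htr⟩ := maximallyMixed_mem_quantumStates hm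
  refine and_congr ⟨fun h => ?_, fun h => h.sub hpos.1⟩ ?_
  · exact sub_add_cancel x (maximallyMixed m) ▸ IsHermitian.add h hpos.1
  · change (x - maximallyMixed m).trace = 0 ↔ _
    rw [trace_sub, htr, sub_eq_zero]

lemma reTraceForm_sub_maximallyMixed (hm : m ≠ 0) {x y : Matrix (Fin m) (Fin m) ℂ}
    (hx : x.trace = 1) (hy : y.trace = 1) :
    reTraceForm m (y - maximallyMixed m) (x - maximallyMixed m) =
      (y * x).trace.re - (m : ℝ)⁻¹ := by
  have hm' : (m : ℝ) ≠ 0 := Nat.cast_ne_zero.2 hm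
  simp [reTraceForm_apply, maximallyMixed_eq_real_smul, mul_sub, trace_smul, hx, hy, hm']

lemma posSemidef_iff_forall_quantumStates {x : Matrix (Fin m) (Fin m) ℂ} (hx : x.IsHermitian) :
    x.PosSemidef ↔ ∀ y ∈ quantumStates m, 0 ≤ (y * x).trace.re := by
  refine ⟨fun h y hy => re_trace_mul_nonneg_of_posSemidef hy.1 h, fun h =>
    .of_dotProduct_mulVec_nonneg hx fun v => ?_⟩
  rcases eq_or_ne v 0 with rfl | hv
  · simp
  have hre := h _ (pureState_mem_quantumStates hv)
  rw [pureState, smul_mul_assoc, trace_smul, Complex.real_smul, Complex.re_ofReal_mul,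
    trace_dyad_mul, mul_nonneg_iff_of_pos_left (inv_pos.2 (sum_norm_sq_pos hv))] at hre
  exact Complex.le_def.2 ⟨hre, (hx.im_star_dotProduct_mulVec_self v).symm⟩

/- Up to scaling, the polarity of the quantum states is the self-duality of the cone of positive
semidefinite matrices, since `-m (tr (σ ρ) - 1 / m) ≤ 1` exactly when `0 ≤ tr (σ ρ)`. -/
lemma affinePolar_quantumStates (hm : m ≠ 0) :
    affinePolar (-(m : ℝ) • reTraceForm m) (tracelessHermitian m) (maximallyMixed m)
      (quantumStates m) = quantumStates m := by
  ext x
  have hm_pos : (0 : ℝ) < m := by positivity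
  have form_le_one_iff : x.trace = 1 → ∀ y ∈ quantumStates m,
      ((-(m : ℝ) • reTraceForm m) (y - maximallyMixed m) (x - maximallyMixed m) ≤ 1 ↔
        0 ≤ (y * x).trace.re) := fun hx y hy => by
    rw [LinearMap.smul_apply, LinearMap.smul_apply, reTraceForm_sub_maximallyMixed hm hx hy.2,
      smul_eq_mul, mul_sub, neg_mul, neg_mul, mul_inv_cancel₀ hm_pos.ne', neg_sub_neg,
      sub_le_self_iff, mul_nonneg_iff_of_pos_left hm_pos]
  rw [affinePolar, Set.mem_ofPred_eq, sub_maximallyMixed_mem_tracelessHermitian_iff hm]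
  constructor
  · rintro ⟨⟨hherm, htr⟩, h⟩
    exact ⟨(posSemidef_iff_forall_quantumStates hherm).2 fun y hy =>
      (form_le_one_iff htr y hy).1 (h y hy), htr⟩
  · rintro ⟨hpos, htr⟩
    exact ⟨⟨hpos.1, htr⟩, fun y hy => (form_le_one_iff htr y hy).2
      ((posSemidef_iff_forall_quantumStates hpos.1).1 hpos y hy)⟩

instance : LocallyConvexSpace ℝ (Matrix (Fin m) (Fin m) ℂ) :=
  inferInstanceAs (LocallyConvexSpace ℝ (Fin m → Fin m → ℂ))

theorem facialDim_quantumStates_eq_verticialDim (hm : 2 ≤ m) {A : ℝ} (hA : A ≠ 0) :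
    facialDim (maximallyMixed m) (quantumStates m) A =
      verticialDim (maximallyMixed m) (quantumStates m) A :=
  facialDim_eq_verticialDim_of_affinePolar_eq_self hA (isCompact_quantumStates m)
    (quantumStates_nontrivial hm) (affinePolar_quantumStates (by omega))

end QuantumStates

section LatticePoints

lemma sum_Icc_half_pow_natAbs (n : ℕ) :
    ∑ a ∈ Finset.Icc (-(n : ℤ)) n, (1 / 2 : ℝ) ^ a.natAbs = 3 - 2 * (1 / 2) ^ n := by
  induction n with
  | zero => norm_num
  | succ n ih =>
    have hIcc : Finset.Icc (-((n + 1 : ℕ) : ℤ)) ((n + 1 : ℕ) : ℤ) =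
        insert ((n + 1 : ℕ) : ℤ) (insert (-((n + 1 : ℕ) : ℤ)) (Finset.Icc (-(n : ℤ)) n)) := by
      ext a
      simp only [Finset.mem_Icc, Finset.mem_insert]
      omega
    rw [hIcc, Finset.sum_insert, Finset.sum_insert, ih, Int.natAbs_neg, Int.natAbs_natCast]
    · ring
    · simp
    · simp only [Finset.mem_Icc, Finset.mem_insert]
      omega

/- Weighting `g` by `2 ^ (K - ∑ i, |g i|)`, which is at least `1` on the ball, makes the sum over
the box factor. -/
lemma encard_sum_natAbs_le_le (ι : Type*) [Fintype ι] (K : ℕ) :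
    {g : ι → ℤ | ∑ i, (g i).natAbs ≤ K}.encard ≤ (2 ^ K * 3 ^ Fintype.card ι : ℕ) := by
  classical
  set box := Fintype.piFinset fun _ : ι => Finset.Icc (-(K : ℤ)) K
  set ball := box.filter fun g => ∑ i, (g i).natAbs ≤ K
  have hball : {g : ι → ℤ | ∑ i, (g i).natAbs ≤ K} ⊆ ball := fun _ hg => by
    refine Finset.mem_filter.2 ⟨Fintype.mem_piFinset.2 fun i => Finset.mem_Icc.2 ?_, hg⟩
    have hi := (Finset.single_le_sum (fun _ _ => zero_le) (Finset.mem_univ i)).trans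
      (Set.mem_ofPred_eq ▸ hg)
    omega
  have hweight : (ball.card : ℝ) * (1 / 2) ^ K ≤ 3 ^ Fintype.card ι := calc
    (ball.card : ℝ) * (1 / 2) ^ K = ∑ _g ∈ ball, (1 / 2 : ℝ) ^ K := by
      rw [Finset.sum_const, nsmul_eq_mul]
    _ ≤ ∑ g ∈ ball, ∏ i, (1 / 2 : ℝ) ^ (g i).natAbs := by
      refine Finset.sum_le_sum fun g hg => ?_
      rw [Finset.prod_pow_eq_pow_sum]
      exact pow_le_pow_of_le_one (by norm_num) (by norm_num) (Finset.mem_filter.1 hg).2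
    _ ≤ ∑ g ∈ box, ∏ i, (1 / 2 : ℝ) ^ (g i).natAbs :=
      Finset.sum_le_sum_of_subset_of_nonneg (Finset.filter_subset _ _) fun _ _ _ => by positivity
    _ = ∏ _i : ι, ∑ a ∈ Finset.Icc (-(K : ℤ)) K, (1 / 2 : ℝ) ^ a.natAbs :=
      Finset.sum_prod_piFinset (R := ℝ) _ fun (_ : ι) (a : ℤ) => (1 / 2 : ℝ) ^ a.natAbs
    _ ≤ ∏ _i : ι, (3 : ℝ) := by
      refine Finset.prod_le_prod (fun _ _ => by positivity) fun _ _ => ?_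
      rw [sum_Icc_half_pow_natAbs]
      exact sub_le_self _ (by positivity)
    _ = 3 ^ Fintype.card ι := by rw [Finset.prod_const, Finset.card_univ]
  refine (Set.encard_le_encard hball).trans ?_
  rw [Set.encard_coe_eq_coe_finsetCard, Nat.cast_le, ← Nat.cast_le (α := ℝ)]
  rw [one_div, inv_pow, ← div_eq_mul_inv, div_le_iff₀ (by positivity)] at hweight
  push_cast
  linarith

end LatticePoints

section Rounding

variable {ι M N : Type*} [AddCommGroup M] [Module ℝ M] [AddCommGroup N] [Module ℝ N]
  {Q : QuadraticMap ℝ M N} {C : PointedCone ℝ N}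

lemma quadraticMap_add_smul (Q : QuadraticMap ℝ M N) (y u : M) (θ : ℝ) :
    Q (y + θ • u) + (θ * (1 - θ)) • Q u = (1 - θ) • Q y + θ • Q (y + u) := by
  rw [QuadraticMap.map_add Q, QuadraticMap.map_add Q, Q.map_smul, QuadraticMap.polar_smul_right]
  module

lemma quadraticMap_add_smul_add_mem {y u : M} {r : N} {θ : ℝ} (h₀ : 0 ≤ θ) (h₁ : θ ≤ 1)
    (hu : Q u ∈ C) (hy : Q y + r ∈ C) (hyu : Q (y + u) + r ∈ C) :
    Q (y + θ • u) + (Q u + r) ∈ C := by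
  have hdecomp : Q (y + θ • u) + (Q u + r) =
      (1 - θ) • (Q y + r) + θ • (Q (y + u) + r) + (1 - θ * (1 - θ)) • Q u := by
    rw [eq_sub_of_add_eq (quadraticMap_add_smul Q y u θ)]
    module
  rw [hdecomp]
  exact C.add_mem (C.add_mem (C.smul_mem (by linarith) hy) (C.smul_mem h₀ hyu))
    (C.smul_mem (by nlinarith) hu)

variable [Fintype ι] {v : ι → M} {K : ℕ}

lemma quadraticMap_sum_add_sum_mem
    (hC : ∀ g : ι → ℤ, ∑ i, (g i).natAbs ≤ K → Q (∑ i, g i • v i) ∈ C)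
    {θ : ι → ℝ} (h₀ : ∀ i, 0 ≤ θ i) (h₁ : ∀ i, θ i ≤ 1) (T : Finset ι) :
    ∀ g : ι → ℤ, ∑ i, (g i).natAbs + T.card ≤ K →
      Q (∑ i, g i • v i + ∑ i ∈ T, θ i • v i) + ∑ i ∈ T, Q (v i) ∈ C := by
  classical
  induction T using Finset.induction_on with
  | empty => simpa using hC
  | insert j T hj ih =>
    intro g hg
    rw [Finset.card_insert_of_notMem hj] at hg
    have hsingle : ∑ i, (Pi.single j 1 : ι → ℤ) i • v i = v j := by
      simp [Pi.single_apply, ite_smul]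
    have hnatAbs : ∑ i, ((Pi.single j 1 : ι → ℤ) i).natAbs = 1 := by
      simp [Pi.single_apply, apply_ite Int.natAbs]
    have hshift : ∑ i, ((g + Pi.single j 1 : ι → ℤ) i).natAbs ≤ ∑ i, (g i).natAbs + 1 := by
      rw [← hnatAbs, ← Finset.sum_add_distrib]
      exact Finset.sum_le_sum fun i _ => Int.natAbs_add_le _ _
    have hj_mem : Q (v j) ∈ C := hsingle ▸ hC (Pi.single j 1) (by omega)
    have hg_add := ih (g + Pi.single j 1) (by omega)
    simp only [Pi.add_apply, add_smul, Finset.sum_add_distrib, hsingle] at hg_add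
    rw [Finset.sum_insert hj, Finset.sum_insert hj, add_comm (θ j • v j),
      ← add_assoc (∑ i, g i • v i)]
    rw [add_right_comm] at hg_add
    exact quadraticMap_add_smul_add_mem (h₀ j) (h₁ j) hj_mem (ih g (by omega)) hg_add

/- Rounding the coefficients independently and without bias to integers adds to `Q` at most the
sum of the variances times the values at the `v i`. -/
lemma quadraticMap_sum_smul_add_sum_mem
    (hC : ∀ g : ι → ℤ, ∑ i, (g i).natAbs ≤ K → Q (∑ i, g i • v i) ∈ C)
    {a : ι → ℝ} (ha : ∑ i, |a i| + 2 * Fintype.card ι ≤ K) :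
    Q (∑ i, a i • v i) + ∑ i, Q (v i) ∈ C := by
  have hfloor (i : ι) : |(⌊a i⌋ : ℝ)| ≤ |a i| + 1 := by
    calc |(⌊a i⌋ : ℝ)| = |a i - Int.fract (a i)| := by rw [Int.self_sub_fract]
      _ ≤ |a i| + |Int.fract (a i)| := abs_sub _ _
      _ ≤ |a i| + 1 := by rw [Int.abs_fract]; gcongr; exact (Int.fract_lt_one _).le
  have hsum : ∑ i, (⌊a i⌋).natAbs + Fintype.card ι ≤ K := by
    have h := Finset.sum_le_sum fun i (_ : i ∈ Finset.univ) => hfloor i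
    rw [Finset.sum_add_distrib, Finset.sum_const, Finset.card_univ, nsmul_one] at h
    rw [← Nat.cast_le (α := ℝ)]
    push_cast [Nat.cast_natAbs]
    linarith
  have hsplit : ∑ i, a i • v i = ∑ i, ⌊a i⌋ • v i + ∑ i, Int.fract (a i) • v i := by
    simp only [← Finset.sum_add_distrib, ← Int.cast_smul_eq_zsmul ℝ, ← add_smul,
      Int.floor_add_fract]
  rw [hsplit]
  exact quadraticMap_sum_add_sum_mem hC (fun _ => Int.fract_nonneg _)
    (fun _ => (Int.fract_lt_one _).le) Finset.univ _ hsum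

end Rounding

lemma inv_smul_mem_convexHull_of_mem_hull {E : Type*} [AddCommGroup E] [Module ℝ E]
    {φ : E →ₗ[ℝ] ℝ} {S : Set E} (hφ : ∀ x ∈ S, φ x = 1) {x : E} (hx : x ∈ PointedCone.hull ℝ S)
    (hφx : 0 < φ x) : (φ x)⁻¹ • x ∈ convexHull ℝ S := by
  obtain ⟨c, hcS, rfl⟩ := Submodule.mem_span_set.1 hx
  have hsum : φ (c.sum fun y r => r • y) = ∑ y ∈ c.support, (c y : ℝ) := by
    rw [Finsupp.sum, map_sum]
    refine Finset.sum_congr rfl fun y hy => ?_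
    exact (map_smul φ (c y : ℝ) y).trans (by rw [hφ y (hcS hy), smul_eq_mul, mul_one])
  rw [hsum] at hφx ⊢
  exact Finset.centerMass_mem_convexHull c.support (fun y _ => (c y).2) hφx fun y hy => hcS hy

section UpperBound

variable {m : ℕ}

/-- The real basis of `ℂ^m` made of the vectors `e k` and `i e k`. -/
noncomputable def realBasis (m : ℕ) : Module.Basis ((_ : Fin m) × Fin 2) ℝ (Fin m → ℂ) :=
  Pi.basis fun _ => Complex.basisOneI

lemma card_realBasis_index (m : ℕ) : Fintype.card ((_ : Fin m) × Fin 2) = 2 * m := by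
  simp [mul_comm]

lemma sum_realBasis_repr_sq (x : Fin m → ℂ) :
    ∑ i, (realBasis m).repr x i ^ 2 = ∑ k, ‖x k‖ ^ 2 := by
  simp [realBasis, Fintype.sum_sigma, Complex.sq_norm, Complex.normSq_apply, sq (Complex.re _),
    sq (Complex.im _)]

lemma sum_abs_realBasis_repr_le (x : Fin m → ℂ) :
    ∑ i, |(realBasis m).repr x i| ≤ (∑ k, ‖x k‖ ^ 2) / 2 + m := by
  have habs (t : ℝ) : |t| ≤ t ^ 2 / 2 + 1 / 2 := by
    rw [← sq_abs]
    nlinarith [sq_nonneg (|t| - 1)]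
  calc ∑ i, |(realBasis m).repr x i|
      ≤ ∑ i, ((realBasis m).repr x i ^ 2 / 2 + 1 / 2) := Finset.sum_le_sum fun i _ => habs _
    _ = (∑ k, ‖x k‖ ^ 2) / 2 + m := by
      rw [Finset.sum_add_distrib, ← Finset.sum_div, sum_realBasis_repr_sq, Finset.sum_const,
        Finset.card_univ, card_realBasis_index, nsmul_eq_mul]
      push_cast
      ring

lemma sum_dyad_realBasis (m : ℕ) :
    ∑ i, dyad (Fin m) (realBasis m i) = (2 : ℝ) • (1 : Matrix (Fin m) (Fin m) ℂ) := by
  ext j l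
  simp [realBasis, Fintype.sum_sigma, Matrix.sum_apply, dyad_apply, vecMulVec_apply,
    Pi.single_apply, Matrix.one_apply, one_add_one_eq_two]

/-- The projections onto the lines spanned by the nonzero Gaussian integer vectors in an `ℓ¹` ball,
whose dilates span the approximating polytope. -/
def latticePureStates (m : ℕ) : Set (Matrix (Fin m) (Fin m) ℂ) :=
  pureState '' ((fun g : (_ : Fin m) × Fin 2 → ℤ => ∑ i, g i • realBasis m i) ''
    {g | ∑ i, (g i).natAbs ≤ 6 * m} \ {0})

lemma encard_latticePureStates_le (m : ℕ) :
    (latticePureStates m).encard ≤ (2 ^ (6 * m) * 3 ^ (2 * m) : ℕ) := by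
  refine (Set.encard_image_le _ _).trans <| (Set.encard_le_encard Set.sdiff_subset).trans <|
    (Set.encard_image_le _ _).trans ?_
  rw [← card_realBasis_index]
  exact encard_sum_natAbs_le_le _ _

lemma latticePureStates_subset_quantumStates : latticePureStates m ⊆ quantumStates m := by
  rintro _ ⟨x, ⟨-, hx⟩, rfl⟩
  exact pureState_mem_quantumStates hx

lemma dyad_mem_hull_latticePureStates {g : (_ : Fin m) × Fin 2 → ℤ}
    (hg : ∑ i, (g i).natAbs ≤ 6 * m) :
    dyad (Fin m) (∑ i, g i • realBasis m i) ∈ PointedCone.hull ℝ (latticePureStates m) := by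
  set x := ∑ i, g i • realBasis m i with hxg
  rcases eq_or_ne x 0 with hx | hx
  · rw [hx, QuadraticMap.map_zero]
    exact zero_mem _
  · rw [← sum_norm_sq_smul_pureState hx]
    exact PointedCone.smul_mem _ (sum_norm_sq_pos hx).le
      (PointedCone.subset_hull ⟨x, ⟨⟨g, hg, hxg.symm⟩, hx⟩, rfl⟩)

lemma maximallyMixed_mem_hull_latticePureStates (m : ℕ) :
    maximallyMixed m ∈ PointedCone.hull ℝ (latticePureStates m) := by
  have hbound : ∑ i, |(0 : (_ : Fin m) × Fin 2 → ℝ) i| +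
      2 * Fintype.card ((_ : Fin m) × Fin 2) ≤ (6 * m : ℕ) := by
    rw [card_realBasis_index]
    push_cast
    simp only [Pi.zero_apply, abs_zero, Finset.sum_const_zero]
    linarith [(m.cast_nonneg : (0 : ℝ) ≤ m)]
  have hzero := quadraticMap_sum_smul_add_sum_mem
    (fun _ => dyad_mem_hull_latticePureStates) hbound
  simp only [Pi.zero_apply, zero_smul, Finset.sum_const_zero, QuadraticMap.map_zero, zero_add,
    sum_dyad_realBasis] at hzero
  convert PointedCone.smul_mem _ (show 0 ≤ (m : ℝ)⁻¹ * 2⁻¹ by positivity) hzero using 1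
  rw [maximallyMixed_eq_real_smul, smul_smul, inv_mul_cancel_right₀ two_ne_zero]

lemma dyad_add_smul_maximallyMixed_mem_hull (x : Fin m → ℂ) :
    dyad (Fin m) x + (2 * ∑ k, ‖x k‖ ^ 2) • maximallyMixed m ∈
      PointedCone.hull ℝ (latticePureStates m) := by
  rcases eq_or_ne x 0 with rfl | hx
  · simp
  have hs := sum_norm_sq_pos hx
  set s := ∑ k, ‖x k‖ ^ 2 with hs_def
  have hm : (0 : ℝ) < m := by
    obtain ⟨k, -⟩ := Function.ne_iff.1 hx
    exact_mod_cast k.pos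
  set y := √(m / s) • x
  have hy : ∑ k, ‖y k‖ ^ 2 = m := by
    simp only [y, Pi.smul_apply, norm_smul, mul_pow, ← Finset.mul_sum, ← hs_def]
    rw [Real.norm_eq_abs, sq_abs, Real.sq_sqrt (by positivity), div_mul_cancel₀ _ hs.ne']
  have hround : dyad (Fin m) y + (2 : ℝ) • (1 : Matrix (Fin m) (Fin m) ℂ) ∈
      PointedCone.hull ℝ (latticePureStates m) := by
    rw [← sum_dyad_realBasis, ← (realBasis m).sum_repr y]
    refine quadraticMap_sum_smul_add_sum_mem (fun _ => dyad_mem_hull_latticePureStates) ?_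
    have habs := sum_abs_realBasis_repr_le y
    rw [hy] at habs
    rw [card_realBasis_index]
    push_cast
    linarith
  convert PointedCone.smul_mem _ (div_pos hs hm).le hround using 1
  rw [QuadraticMap.map_smul, maximallyMixed_eq_real_smul, Real.mul_self_sqrt (by positivity),
    smul_add, smul_smul, smul_smul, smul_smul, div_mul_div_cancel₀ hm.ne', div_self hs.ne',
    one_smul]
  congr 2
  ring

lemma add_smul_maximallyMixed_mem_hull {ρ : Matrix (Fin m) (Fin m) ℂ} (hρ : ρ ∈ quantumStates m) :
    ρ + (2 : ℝ) • maximallyMixed m ∈ PointedCone.hull ℝ (latticePureStates m) := by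
  obtain ⟨hpos, htr⟩ := hρ
  obtain ⟨B, rfl⟩ := exists_eq_conjTranspose_mul_self_of_posSemidef hpos
  rw [conjTranspose_mul_self_eq_sum_dyad] at htr ⊢
  simp only [trace_sum, trace_dyad, ← Complex.ofReal_sum, Complex.ofReal_eq_one] at htr
  have hsum := sum_mem fun r (_ : r ∈ Finset.univ) =>
    dyad_add_smul_maximallyMixed_mem_hull (star (B r))
  rwa [Finset.sum_add_distrib, ← Finset.sum_smul, ← Finset.mul_sum, htr, mul_one] at hsum

lemma quantumStates_subset_homothety_convexHull {A : ℝ} (hA : 3 ≤ A) :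
    quantumStates m ⊆
      AffineMap.homothety (maximallyMixed m) A '' convexHull ℝ (latticePureStates m) := by
  intro ρ hρ
  have htrace {σ : Matrix (Fin m) (Fin m) ℂ} (hσ : σ ∈ quantumStates m) :
      (Complex.reLm ∘ₗ traceLinearMap (Fin m) ℝ ℂ) σ = 1 := by
    simp [hσ.2]
  have hm : m ≠ 0 := by
    rintro rfl
    simpa using hρ.2
  have hmem := add_mem (add_smul_maximallyMixed_mem_hull hρ)
    (PointedCone.smul_mem _ (sub_nonneg.2 hA) (maximallyMixed_mem_hull_latticePureStates m))
  have hA' : (Complex.reLm ∘ₗ traceLinearMap (Fin m) ℝ ℂ)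
      (ρ + (2 : ℝ) • maximallyMixed m + (A - 3) • maximallyMixed m) = A := by
    rw [map_add, map_add, map_smul, map_smul, htrace hρ,
      htrace (maximallyMixed_mem_quantumStates hm), smul_eq_mul, smul_eq_mul]
    ring
  have hhull := inv_smul_mem_convexHull_of_mem_hull
    (fun σ hσ => htrace (latticePureStates_subset_quantumStates hσ)) hmem (by rw [hA']; linarith)
  have hA0 : A ≠ 0 := by linarith
  rw [hA'] at hhull
  rw [mem_homothety_image_iff hA0]
  convert hhull using 1
  rw [eq_inv_smul_iff₀ hA0, smul_add, smul_inv_smul₀ hA0]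
  module

lemma isSandwichedPolytope_convexHull_homothety_image {A : ℝ} (hA : 3 ≤ A) :
    IsSandwichedPolytope (maximallyMixed m) (quantumStates m) A
      (convexHull ℝ (AffineMap.homothety (maximallyMixed m) A '' latticePureStates m)) where
  isPolytope :=
    ⟨_, (Set.finite_of_encard_le_coe (encard_latticePureStates_le m)).image _, rfl⟩
  subset := by
    rw [← AffineMap.image_convexHull]
    exact quantumStates_subset_homothety_convexHull hA
  subset_homothety := by
    rw [← AffineMap.image_convexHull]
    exact Set.image_mono
      (convexHull_min latticePureStates_subset_quantumStates (convex_quantumStates m))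

theorem verticialDim_quantumStates_le (m : ℕ) {A : ℝ} (hA : 3 ≤ A) :
    verticialDim (maximallyMixed m) (quantumStates m) A ≤
      (6 * Real.log 2 + 2 * Real.log 3) * m := by
  have hcard := (Set.encard_le_encard (extremePoints_convexHull_subset (𝕜 := ℝ))).trans <|
    (Set.encard_image_le (AffineMap.homothety (maximallyMixed m) A) _).trans
      (encard_latticePureStates_le m)
  refine ((isSandwichedPolytope_convexHull_homothety_image hA).verticialDim_le hcard).trans_eq ?_
  push_cast
  rw [Real.log_mul (by positivity) (by positivity), Real.log_pow, Real.log_pow]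
  push_cast
  ring

end UpperBound

section RademacherSums

variable {E : Type*} [NormedAddCommGroup E] [InnerProductSpace ℝ E]

lemma exp_mul_norm_add_sq_add_exp_mul_norm_sub_sq_le (a x : E) {t : ℝ} (ht : t ≤ 1 / 2) :
    Real.exp (t * ‖x + a‖ ^ 2) + Real.exp (t * ‖x - a‖ ^ 2) ≤
      2 * Real.exp (‖a‖ ^ 2 / 2) * Real.exp (t * (1 + 2 * t * ‖a‖ ^ 2) * ‖x‖ ^ 2) := by
  set p := inner ℝ x a
  have hp : p ^ 2 ≤ ‖x‖ ^ 2 * ‖a‖ ^ 2 := by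
    rw [← mul_pow, ← sq_abs p]
    exact pow_le_pow_left₀ (abs_nonneg _) (abs_real_inner_le_norm x a) 2
  calc Real.exp (t * ‖x + a‖ ^ 2) + Real.exp (t * ‖x - a‖ ^ 2)
      = 2 * Real.exp (t * (‖x‖ ^ 2 + ‖a‖ ^ 2)) * Real.cosh (2 * t * p) := by
        have hadd : t * ‖x + a‖ ^ 2 = t * (‖x‖ ^ 2 + ‖a‖ ^ 2) + 2 * t * p := by
          rw [norm_add_sq_real]
          ring
        have hsub : t * ‖x - a‖ ^ 2 = t * (‖x‖ ^ 2 + ‖a‖ ^ 2) + -(2 * t * p) := by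
          rw [norm_sub_sq_real]
          ring
        rw [hadd, hsub, Real.exp_add, Real.exp_add, Real.cosh_eq]
        ring
    _ ≤ 2 * Real.exp (t * (‖x‖ ^ 2 + ‖a‖ ^ 2)) * Real.exp ((2 * t * p) ^ 2 / 2) := by
        gcongr
        exact Real.cosh_le_exp_half_sq _
    _ ≤ _ := by
        rw [mul_assoc 2, ← Real.exp_add, mul_assoc 2 (Real.exp (‖a‖ ^ 2 / 2)), ← Real.exp_add]
        gcongr 2 * Real.exp ?_
        have hta : t * ‖a‖ ^ 2 ≤ 1 / 2 * ‖a‖ ^ 2 := by gcongr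
        have htp : t ^ 2 * p ^ 2 ≤ t ^ 2 * (‖x‖ ^ 2 * ‖a‖ ^ 2) := by gcongr
        linarith

/- Averaging over one sign replaces `t` by `t (1 + 2 t ‖a‖ ^ 2)`, which lowers `1 / t` by at most
`2 ‖a‖ ^ 2`. -/
theorem sum_exp_mul_norm_sum_units_smul_sq_le {n : ℕ} (a : Fin n → E) {t : ℝ} (ht : 0 ≤ t)
    (h : t * (2 + 2 * ∑ k, ‖a k‖ ^ 2) ≤ 1) :
    ∑ ε : Fin n → ℤˣ, Real.exp (t * ‖∑ k, ε k • a k‖ ^ 2) ≤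
      2 ^ n * Real.exp ((∑ k, ‖a k‖ ^ 2) / 2) := by
  induction n generalizing t with
  | zero => simp
  | succ n ih =>
    rw [Fin.sum_univ_succ] at h ⊢
    set α := ‖a 0‖ ^ 2
    set V := ∑ k : Fin n, ‖a k.succ‖ ^ 2
    have hα : 0 ≤ α := sq_nonneg _
    have hV : 0 ≤ V := Finset.sum_nonneg fun _ _ => sq_nonneg _
    have htα : 0 ≤ t * α := mul_nonneg ht hα
    have htV : 0 ≤ t * V := mul_nonneg ht hV
    have ht' : t * (1 + 2 * t * α) * (2 + 2 * V) ≤ 1 := by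
      calc t * (1 + 2 * t * α) * (2 + 2 * V)
          = t * (2 + 2 * V) * (1 + 2 * t * α) := by ring
        _ ≤ (1 - 2 * t * α) * (1 + 2 * t * α) := by
          gcongr
          linarith
        _ ≤ 1 := by nlinarith [sq_nonneg (2 * t * α)]
    calc ∑ ε : Fin (n + 1) → ℤˣ, Real.exp (t * ‖∑ k, ε k • a k‖ ^ 2)
        = ∑ ε : Fin n → ℤˣ, (Real.exp (t * ‖∑ k, ε k • a k.succ + a 0‖ ^ 2) +
            Real.exp (t * ‖∑ k, ε k • a k.succ - a 0‖ ^ 2)) := by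
          rw [← (Fin.consEquiv fun _ => ℤˣ).sum_comp, Fintype.sum_prod_type_right]
          refine Finset.sum_congr rfl fun ε _ => ?_
          simp [Fin.consEquiv, Fin.sum_univ_succ, UnitsInt.univ, add_comm, sub_eq_add_neg]
      _ ≤ ∑ ε : Fin n → ℤˣ, 2 * Real.exp (α / 2) *
            Real.exp (t * (1 + 2 * t * α) * ‖∑ k, ε k • a k.succ‖ ^ 2) :=
          Finset.sum_le_sum fun ε _ =>
            exp_mul_norm_add_sq_add_exp_mul_norm_sub_sq_le _ _ (by linarith)
      _ ≤ 2 * Real.exp (α / 2) * (2 ^ n * Real.exp (V / 2)) := by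
          rw [← Finset.mul_sum]
          gcongr
          exact ih (fun k => a k.succ) (by positivity) ht'
      _ = 2 ^ (n + 1) * Real.exp ((α + V) / 2) := by
          rw [add_div, Real.exp_add]
          ring

end RademacherSums

lemma card_mul_exp_le_card_mul {Ω α : Type*} [Fintype Ω] {V : Finset α} {f : Ω → α → ℝ} {b c : ℝ}
    (hc : ∀ ω, ∃ v ∈ V, c ≤ f ω v) (hb : ∀ v ∈ V, ∑ ω, Real.exp (f ω v) ≤ b) :
    Fintype.card Ω * Real.exp c ≤ V.card * b := by
  calc Fintype.card Ω * Real.exp c = ∑ _ω : Ω, Real.exp c := by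
        rw [Finset.sum_const, Finset.card_univ, nsmul_eq_mul]
    _ ≤ ∑ ω, ∑ v ∈ V, Real.exp (f ω v) := Finset.sum_le_sum fun ω _ => by
        obtain ⟨v, hv, hcv⟩ := hc ω
        exact (Real.exp_le_exp.2 hcv).trans <|
          Finset.single_le_sum (f := fun v => Real.exp (f ω v)) (fun _ _ => (Real.exp_pos _).le) hv
    _ = ∑ v ∈ V, ∑ ω, Real.exp (f ω v) := Finset.sum_comm
    _ ≤ V.card * b := by
        rw [← nsmul_eq_mul]
        exact Finset.sum_le_card_nsmul _ _ _ hb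

section LowerBound

variable {m : ℕ}

/-- The vector in `ℂ^m` whose entries are the signs `ε`. -/
def signVector (ε : Fin m → ℤˣ) : Fin m → ℂ := fun k => ((ε k : ℤ) : ℂ)

lemma sum_norm_sq_signVector (ε : Fin m → ℤˣ) : ∑ k, ‖signVector ε k‖ ^ 2 = m := by
  have hnorm (k : Fin m) : ‖signVector ε k‖ = 1 := by
    rcases Int.units_eq_one_or (ε k) with h | h <;> simp [signVector, h]
  simp [hnorm]

lemma signVector_ne_zero (hm : m ≠ 0) (ε : Fin m → ℤˣ) : signVector ε ≠ 0 := by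
  intro h
  have hsum := sum_norm_sq_signVector ε
  rw [h] at hsum
  exact hm (by simpa using hsum.symm)

lemma reTraceForm_dyad_conjTranspose_mul_self (x : Fin m → ℂ) (B : Matrix (Fin m) (Fin m) ℂ) :
    reTraceForm m (dyad (Fin m) x) (Bᴴ * B) = ∑ r, ‖(B *ᵥ x) r‖ ^ 2 := by
  rw [reTraceForm_apply, trace_dyad_mul, ← mulVec_mulVec, dotProduct_mulVec, ← star_mulVec,
    dotProduct, Complex.re_sum]
  refine Finset.sum_congr rfl fun r _ => ?_
  rw [Pi.star_apply, Complex.sq_norm, ← Complex.ofReal_re (Complex.normSq _),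
    Complex.normSq_eq_conj_mul_self, starRingEnd_apply]

lemma reTraceForm_dyad_maximallyMixed (x : Fin m → ℂ) :
    reTraceForm m (dyad (Fin m) x) (maximallyMixed m) = (∑ k, ‖x k‖ ^ 2) / m := by
  rw [maximallyMixed_eq_real_smul, map_smul, reTraceForm_apply, Matrix.mul_one, trace_dyad,
    Complex.ofReal_re, smul_eq_mul, inv_mul_eq_div]

lemma reTraceForm_dyad_pureState_self (x : Fin m → ℂ) :
    reTraceForm m (dyad (Fin m) x) (pureState x) = ∑ k, ‖x k‖ ^ 2 := by
  have hself : star x ⬝ᵥ x = ((∑ k, ‖x k‖ ^ 2 : ℝ) : ℂ) := by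
    rw [← trace_dyad, dyad_apply, trace_vecMulVec, dotProduct_comm]
  rw [pureState, map_smul, reTraceForm_apply, trace_dyad_mul, dyad_apply, vecMulVec_mulVec,
    op_smul_eq_smul, dotProduct_smul, hself, smul_eq_mul, smul_eq_mul, ← Complex.ofReal_mul,
    Complex.ofReal_re]
  rcases eq_or_ne (∑ k, ‖x k‖ ^ 2) 0 with h | h
  · simp [h]
  · exact inv_mul_cancel_left₀ h _

lemma sum_exp_reTraceForm_dyad_signVector_le {ρ : Matrix (Fin m) (Fin m) ℂ}
    (hρ : ρ ∈ quantumStates m) :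
    ∑ ε, Real.exp (1 / 4 * reTraceForm m (dyad (Fin m) (signVector ε)) ρ) ≤
      2 ^ m * Real.exp (1 / 2) := by
  obtain ⟨hpos, htr⟩ := hρ
  obtain ⟨B, rfl⟩ := exists_eq_conjTranspose_mul_self_of_posSemidef hpos
  let column (k : Fin m) : EuclideanSpace ℂ (Fin m) := WithLp.toLp 2 (B.col k)
  have hcolumn : ∑ k, ‖column k‖ ^ 2 = 1 := by
    rw [conjTranspose_mul_self_eq_sum_dyad] at htr
    simp only [trace_sum, trace_dyad, ← Complex.ofReal_sum, Complex.ofReal_eq_one] at htr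
    rw [← htr, Finset.sum_comm]
    exact Finset.sum_congr rfl fun k _ => by simp [column, EuclideanSpace.norm_sq_eq]
  have hform (ε : Fin m → ℤˣ) : reTraceForm m (dyad (Fin m) (signVector ε)) (Bᴴ * B) =
      ‖∑ k, ε k • column k‖ ^ 2 := by
    rw [reTraceForm_dyad_conjTranspose_mul_self, EuclideanSpace.norm_sq_eq]
    simp [column, mulVec, dotProduct, signVector, Units.smul_def, mul_comm]
  simpa only [hform, hcolumn] using
    sum_exp_mul_norm_sum_units_smul_sq_le column (by norm_num) (by rw [hcolumn]; norm_num)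

variable {A : ℝ} {P : Set (Matrix (Fin m) (Fin m) ℂ)}

lemma IsSandwichedPolytope.exists_vertex_div_le_reTraceForm (hm : m ≠ 0) (hA : 1 ≤ A)
    (hP : IsSandwichedPolytope (maximallyMixed m) (quantumStates m) A P) (ε : Fin m → ℤˣ) :
    ∃ v ∈ vertexSet P, m / A ≤ reTraceForm m (dyad (Fin m) (signVector ε))
      (maximallyMixed m + A⁻¹ • (v - maximallyMixed m)) := by
  set φ := reTraceForm m (dyad (Fin m) (signVector ε))
  obtain ⟨v, hv, hle⟩ := hP.isPolytope.exists_mem_vertexSet_le φ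
    (hP.subset (pureState_mem_quantumStates (signVector_ne_zero hm ε)))
  rw [reTraceForm_dyad_pureState_self, sum_norm_sq_signVector] at hle
  refine ⟨v, hv, ?_⟩
  rw [map_add, map_smul, map_sub, reTraceForm_dyad_maximallyMixed, sum_norm_sq_signVector,
    div_self (Nat.cast_ne_zero.2 hm), smul_eq_mul, inv_mul_eq_div]
  have hA0 : 0 < A := by linarith
  calc m / A ≤ φ v / A := by gcongr
    _ ≤ 1 + (φ v - 1) / A := by
      rw [sub_div]
      linarith [(div_le_one hA0).2 hA]

lemma IsSandwichedPolytope.exp_le_encard (hm : m ≠ 0) (hA : 1 ≤ A)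
    (hP : IsSandwichedPolytope (maximallyMixed m) (quantumStates m) A P) {N : ℕ}
    (hN : (vertexSet P).encard = N) : Real.exp (m / (4 * A) - 1 / 2) ≤ N := by
  have hfin := hP.isPolytope.finite_vertexSet
  have hcard : hfin.toFinset.card = N := by
    rwa [hfin.encard_eq_coe_toFinset_card, Nat.cast_inj] at hN
  have hunion := card_mul_exp_le_card_mul (V := hfin.toFinset) (c := 1 / 4 * (m / A))
    (b := 2 ^ m * Real.exp (1 / 2))
    (f := fun ε v => 1 / 4 * reTraceForm m (dyad (Fin m) (signVector ε))
      (maximallyMixed m + A⁻¹ • (v - maximallyMixed m)))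
    (fun ε => by
      obtain ⟨v, hv, hle⟩ := hP.exists_vertex_div_le_reTraceForm hm hA ε
      exact ⟨v, hfin.mem_toFinset.2 hv, by gcongr⟩)
    (fun v hv => sum_exp_reTraceForm_dyad_signVector_le <|
      (mem_homothety_image_iff (by positivity)).1
        (hP.subset_homothety (extremePoints_subset (hfin.mem_toFinset.1 hv))))
  rw [hcard, Fintype.card_fun, Fintype.card_units_int, Fintype.card_fin, Nat.cast_pow,
    Nat.cast_ofNat, mul_left_comm] at hunion
  rw [Real.exp_sub, div_le_iff₀ (Real.exp_pos _), div_mul_eq_div_mul_one_div, mul_comm]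
  convert le_of_mul_le_mul_left hunion (by positivity) using 2
  ring

theorem le_verticialDim_quantumStates (hm : 2 ≤ m) (hA : 3 ≤ A) :
    m / (8 * A) ≤ verticialDim (maximallyMixed m) (quantumStates m) A := by
  refine le_verticialDim (isSandwichedPolytope_convexHull_homothety_image hA) fun P hP N hN => ?_
  have hexp := Real.log_le_log (Real.exp_pos _) (hP.exp_le_encard (by omega) (by linarith) hN)
  rw [Real.log_exp] at hexp
  have htwo : 2 ≤ N := by
    have hV := hP.isPolytope.nontrivial_vertexSet ((quantumStates_nontrivial hm).mono hP.subset)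
    rwa [← Set.one_lt_encard_iff_nontrivial, hN, Nat.one_lt_cast] at hV
  have hlog_two : Real.log 2 ≤ Real.log N := Real.log_le_log two_pos (mod_cast htwo)
  have hsplit : m / (4 * A) = m / (8 * A) + m / (8 * A) := by ring
  linarith [Real.log_two_gt_d9]

end LowerBound

theorem mainTheorem5 :
    ∃ c C : ℝ, 0 < c ∧ 0 < C ∧ ∀ m : ℕ, 2 ≤ m →
      facialDim (maximallyMixed m) (quantumStates m) 4 =
        verticialDim (maximallyMixed m) (quantumStates m) 4 ∧
      c * (m : ℝ) ≤ verticialDim (maximallyMixed m) (quantumStates m) 4 ∧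
      verticialDim (maximallyMixed m) (quantumStates m) 4 ≤ C * (m : ℝ) := by
  refine ⟨1 / (8 * 4), 6 * Real.log 2 + 2 * Real.log 3, by norm_num, by positivity,
    fun m hm => ⟨?_, ?_, ?_⟩⟩
  · exact facialDim_quantumStates_eq_verticialDim hm four_ne_zero
  · rw [one_div_mul_eq_div]
    exact le_verticialDim_quantumStates hm (by norm_num)
  · exact verticialDim_quantumStates_le m (by norm_num)
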